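/- For nonnegative integers $d,n$, let $SR(d,n)$ be the simple graph whose vertices are the integer vectors $x=(x_1,\dots,x_d)$ with $0\le x_i\le n$ for all $i$ and $x_1+\cdots+x_d=n$, two vertices being adjacent if they differ in exactly two coordinates. Then for every integer $n\ge 1$ the number of spanning trees of $SR(3,n)$ is \[ \begin{cases} \dfrac{32\,(2n+3)^{\binom{n-1}{2}}\,\prod_{a=n+2}^{2n+2}a^3}{3\,(n+1)^2\,(n+2)\,(3n+5)^3} & \text{if } n \text{ is odd},\\[3ex] \dfrac{32\,(2n+3)^{\binom{n-1}{2}}\,\prod_{a=n+2}^{2n+2}a^3}{3\,(n+1)\,(n+2)^2\,(3n+4)^3} & \text{if } n \text{ is even}. \end{cases} \] -/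

import Mathlib

/-- The vertex set `V(d, n)`: lattice points `x = (x₁, …, x_d)` with `0 ≤ x_i ≤ n` for all `i`
and `x₁ + ⋯ + x_d = n`. -/
abbrev SimplicialRookVertex (d n : ℕ) : Type :=
  {x : Fin d → ℕ // (∀ i, x i ≤ n) ∧ ∑ i, x i = n}

/-- The simplicial rook graph `SR(d, n)`: two vertices are adjacent if they differ in exactly
two coordinates. -/
def simplicialRookGraph (d n : ℕ) : SimpleGraph (SimplicialRookVertex d n) where
  Adj x y := (Finset.univ.filter fun i => x.1 i ≠ y.1 i).card = 2
  symm := ⟨fun x y h => by simpa only [ne_comm] using h⟩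
  loopless := ⟨fun x h => by simp at h⟩

/-- The set of spanning trees of a graph `G`: trees on the whole vertex set of `G` all of whose
edges are edges of `G`. -/
def spanningTrees {V : Type*} (G : SimpleGraph V) : Set (SimpleGraph V) :=
  {T | T ≤ G ∧ T.IsTree}

/-! Let `N` be the incidence matrix of vertices against the lines `x i = k`. Distinct vertices share
at most one line, and share one exactly when adjacent; each vertex has degree `2n`, so the Laplacian
is `(2n+3)I - N Nᵀ`. Up to zeros, `N Nᵀ` has the spectrum of `Nᵀ N = D ⊗ I + U ⊗ (J - I)`, where `D
= diag (n+1-k)`, `U k l = 1` iff `k + l ≤ n`, and `J` is the 3×3 all-ones matrix. As `J - I` has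
eigenvalues `2, -1, -1`, this splits into `D + 2U` and two copies of `D - U`. Explicit eigenvectors
give their eigenvalues: `0, ..., n+1` with one (`D - U`) or two (`D + 2U`) middle values missing,
and `2n+3` for `D + 2U`. By the matrix-tree theorem each diagonal cofactor of the Laplacian is the
number of spanning trees. The sum of these cofactors is the derivative of the characteristic
polynomial of `N Nᵀ` at its simple root `2n+3`. The missing eigenvalues produce the denominator. -/

/-! ### Derivative of the characteristic polynomial -/

open Matrix Polynomial in
theorem Matrix.derivative_charpoly {m R : Type*} [Fintype m] [DecidableEq m] [CommRing R]
    (A : Matrix m m R) :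
    derivative A.charpoly = ∑ i, A.charmatrix.adjugate i i := by
  -- Differentiating row `i` of `X - A` entrywise gives the basis row `e_i`, which is what the
  -- cofactor puts there.
  have key : ∀ i, A.charmatrix.adjugate i i =
      ∑ σ : Equiv.Perm m, (Equiv.Perm.sign σ : R[X]) *
        ((∏ j ∈ Finset.univ.erase i, A.charmatrix j (σ j)) *
          derivative (A.charmatrix i (σ i))) := by
    intro i
    rw [adjugate_apply, ← det_transpose, det_apply']
    refine Finset.sum_congr rfl fun σ _ => ?_
    rw [← Finset.mul_prod_erase _ _ (Finset.mem_univ i), mul_comm (transpose _ _ _)]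
    congr 2
    · refine Finset.prod_congr rfl fun j hj => ?_
      rw [transpose_apply, updateRow_ne (Finset.ne_of_mem_erase hj)]
    · rw [transpose_apply, updateRow_self, charmatrix_apply, derivative_sub, derivative_C, sub_zero,
        diagonal_apply, Pi.single_apply]
      split_ifs with h1 h2 h2
      · simp
      · exact absurd h1.symm h2
      · exact absurd h2.symm h1
      · simp
  simp_rw [key]
  rw [Finset.sum_comm, charpoly, ← det_transpose, det_apply', derivative_sum]
  refine Finset.sum_congr rfl fun σ _ => ?_
  rw [← Finset.mul_sum, derivative_intCast_mul, derivative_prod_finset]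
  rfl

/-! ### The matrix-tree theorem -/

open Matrix in
/-- The matrix with rows `e_r` at `r` and `e_v - e_{f v}` at `v ≠ r`. -/
def functionalMatrix {V : Type*} [DecidableEq V] (K : Type*) [Ring K] (r : V) (f : V → V) :
    Matrix V V K :=
  fun v => if v = r then Pi.single r 1 else Pi.single v 1 - Pi.single (f v) 1

/-- Ordering vertices by the number of steps to `r` makes the matrix triangular with unit diagonal.
-/
theorem det_functionalMatrix_of_reaches {V : Type*} [Fintype V] [DecidableEq V] (K : Type*)
    [CommRing K] (r : V) (f : V → V) (hf : ∀ v, ∃ k, f^[k] v = r) :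
    (functionalMatrix K r f).det = 1 := by
  classical
  set d : V → ℕ := fun v => Nat.find (hf v) with hd
  have hlt : ∀ v, v ≠ r → d (f v) < d v := by
    intro v hv
    have h1 := Nat.find_spec (hf v)
    obtain ⟨k, hk⟩ : ∃ k, Nat.find (hf v) = k + 1 := by
      apply Nat.exists_eq_succ_of_ne_zero
      intro h0
      rw [h0] at h1
      exact hv h1
    rw [hk, Function.iterate_succ_apply] at h1
    have : d (f v) ≤ k := Nat.find_min' _ h1
    have h2 : d v = k + 1 := hk
    omega
  have hz : ∀ v u, v ≠ u → d v ≤ d u → functionalMatrix K r f v u = 0 := by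
    intro v u hvu hle
    unfold functionalMatrix
    split_ifs with h
    · subst h; simp [hvu.symm]
    · have := hlt v h
      have h3 : u ≠ f v := by rintro rfl; omega
      simp [hvu.symm, h3]
  have hdiag : ∀ v, functionalMatrix K r f v v = 1 := by
    intro v
    unfold functionalMatrix
    split_ifs with h
    · subst h; simp
    · have := hlt v h
      have h3 : v ≠ f v := by intro h; rw [← h] at this; omega
      simp [h3]
  have hbt : (functionalMatrix K r f).transpose.BlockTriangular d := by
    intro i j hij
    rw [Matrix.transpose_apply]
    exact hz j i (by rintro rfl; omega) hij.le
  rw [← Matrix.det_transpose, hbt.det]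
  refine Finset.prod_eq_one fun a _ => ?_
  have : (functionalMatrix K r f).transpose.toSquareBlock d a = 1 := by
    ext ⟨i, hi⟩ ⟨j, hj⟩
    rw [Matrix.toSquareBlock_def, Matrix.of_apply, Matrix.transpose_apply, Matrix.one_apply]
    split_ifs with h
    · cases h; exact hdiag _
    · exact hz j i (fun h' => h (Subtype.ext h'.symm)) (by omega)
  rw [this, Matrix.det_one]

/-- The indicator of the vertices that never reach `r` is a nonzero kernel vector. -/
theorem det_functionalMatrix_of_not_reaches {V : Type*} [Fintype V] [DecidableEq V] (K : Type*)
    [Field K] (r : V) (f : V → V) (hf : ¬ ∀ v, ∃ k, f^[k] v = r) :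
    (functionalMatrix K r f).det = 0 := by
  classical
  push Not at hf
  obtain ⟨w, hw⟩ := hf
  rw [← Matrix.exists_mulVec_eq_zero_iff]
  refine ⟨fun v => if ∀ k, f^[k] v ≠ r then 1 else 0, ?_, ?_⟩
  · intro h
    have := congrFun h w
    simp only [Pi.zero_apply, if_pos hw, one_ne_zero] at this
  · ext v
    rw [Pi.zero_apply, Matrix.mulVec, functionalMatrix]
    split_ifs with h
    · subst h
      rw [single_dotProduct, if_neg (by push Not; exact ⟨0, rfl⟩), mul_zero]
    · rw [sub_dotProduct, single_dotProduct, single_dotProduct, one_mul, one_mul, sub_eq_zero]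
      refine if_congr ⟨fun h' k => ?_, fun h' k => ?_⟩ rfl rfl
      · rw [← Function.iterate_succ_apply]; exact h' _
      · cases k with
        | zero => exact h
        | succ k => exact h' k

/-- Parent functions of spanning trees of `G` rooted at `r`. -/
def parentFunctions {V : Type*} (G : SimpleGraph V) (r : V) : Set (V → V) :=
  {f | f r = r ∧ (∀ v, v ≠ r → G.Adj v (f v)) ∧ ∀ v, ∃ k, f^[k] v = r}

/-- Row `v ≠ r` of the Laplacian is the sum of `e_v - e_u` over neighbours `u`. Multilinearity
expands the cofactor over all choices of a neighbour for each `v`, and each choice contributes 1 or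
0. -/
theorem adjugate_lapMatrix_apply_self {V : Type*} [Fintype V] [DecidableEq V] (K : Type*)
    [Field K] (G : SimpleGraph V) [DecidableRel G.Adj] (r : V) :
    (G.lapMatrix K).adjugate r r = ((parentFunctions G r).ncard : K) := by
  classical
  rw [Matrix.adjugate_apply]
  have hrow : (G.lapMatrix K).updateRow r (Pi.single r 1) = fun v =>
      ∑ u ∈ (if v = r then {r} else G.neighborFinset v),
        (if v = r then Pi.single r 1 else Pi.single v 1 - Pi.single u 1 : V → K) := by
    ext v w
    by_cases h : v = r
    · subst h; simp
    · simp only [Matrix.updateRow_ne h, h, if_false, Finset.sum_sub_distrib, Finset.sum_const,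
        Pi.sub_apply, Finset.sum_apply]
      simp [SimpleGraph.lapMatrix, SimpleGraph.degMatrix, SimpleGraph.adjMatrix_apply,
        Pi.single_apply, Matrix.diagonal_apply, eq_comm]
  rw [hrow]
  refine ((Matrix.detRowAlternating (n := V) (R := K)).toMultilinearMap.map_sum_finset
    _ _).trans ?_
  have hset : parentFunctions G r = ↑((Fintype.piFinset fun v : V =>
      (if v = r then {r} else G.neighborFinset v)).filter fun f => ∀ v, ∃ k, f^[k] v = r) := by
    ext f
    simp only [parentFunctions, Set.mem_ofPred_eq, Finset.coe_filter, Fintype.mem_piFinset,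
      ← and_assoc]
    refine and_congr_left fun _ => ⟨fun ⟨h1, h2⟩ v => ?_, fun h => ⟨?_, fun v hv => ?_⟩⟩
    · split_ifs with h
      · simp [h, h1]
      · simpa using h2 v h
    · simpa using h r
    · simpa [hv] using h v
  rw [hset, Set.ncard_coe_finset, Finset.card_filter, Nat.cast_sum]
  refine Finset.sum_congr rfl fun f _ => ?_
  change (functionalMatrix K r f).det = _
  split_ifs with h
  · rw [det_functionalMatrix_of_reaches K r f h, Nat.cast_one]
  · rw [det_functionalMatrix_of_not_reaches K r f h, Nat.cast_zero]

/-- The graph with edges `{v, f v}` for `v ≠ r`. -/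
def parentGraph {V : Type*} (r : V) (f : V → V) : SimpleGraph V :=
  SimpleGraph.fromEdgeSet ((fun v => s(v, f v)) '' {v | v ≠ r})

theorem parentGraph_adj_parent {V : Type*} {G : SimpleGraph V} {r : V} {f : V → V}
    (hf : f ∈ parentFunctions G r) {v : V} (hv : v ≠ r) : (parentGraph r f).Adj v (f v) := by
  rw [parentGraph, SimpleGraph.fromEdgeSet_adj]
  exact ⟨⟨v, hv, rfl⟩, (hf.2.1 v hv).ne⟩

theorem parentGraph_le {V : Type*} {G : SimpleGraph V} {r : V} {f : V → V}
    (hf : f ∈ parentFunctions G r) : parentGraph r f ≤ G := by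
  intro a b hab
  rw [parentGraph, SimpleGraph.fromEdgeSet_adj] at hab
  obtain ⟨⟨v, hv, h⟩, -⟩ := hab
  have := hf.2.1 v hv
  rcases Sym2.eq_iff.1 h with ⟨rfl, rfl⟩ | ⟨rfl, rfl⟩
  · exact this
  · exact this.symm

theorem parentGraph_connected {V : Type*} {G : SimpleGraph V} {r : V} {f : V → V}
    (hf : f ∈ parentFunctions G r) : (parentGraph r f).Connected := by
  have key : ∀ k v, f^[k] v = r → (parentGraph r f).Reachable v r := by
    intro k
    induction k with
    | zero => rintro v rfl; rfl
    | succ k ih =>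
      intro v hv
      by_cases h : v = r
      · rw [h]
      · exact (parentGraph_adj_parent hf h).reachable.trans (ih _ hv)
  rw [SimpleGraph.connected_iff_exists_forall_reachable]
  exact ⟨r, fun v => let ⟨k, hk⟩ := hf.2.2 v; (key k v hk).symm⟩

theorem parentGraph_isTree {V : Type*} [Finite V] {G : SimpleGraph V} {r : V} {f : V → V}
    (hf : f ∈ parentFunctions G r) : (parentGraph r f).IsTree := by
  have hc := parentGraph_connected hf
  rw [SimpleGraph.isTree_iff_connected_and_card]
  refine ⟨hc, le_antisymm ?_ hc.card_vert_le_card_edgeSet_add_one⟩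
  have h1 : (parentGraph r f).edgeSet ⊆ (fun v => s(v, f v)) '' {v | v ≠ r} := by
    rw [parentGraph, SimpleGraph.edgeSet_fromEdgeSet]
    exact Set.sdiff_subset
  have h2 : ({v | v ≠ r} : Set V).ncard + 1 = Nat.card V := by
    have := Set.ncard_add_ncard_compl ({r} : Set V)
    rw [Set.ncard_singleton] at this
    rw [← this, add_comm]; rfl
  have h3 := Set.ncard_le_ncard h1 (Set.toFinite _)
  have h4 := Set.ncard_image_le (f := fun v => s(v, f v)) (Set.toFinite {v | v ≠ r})
  rw [Nat.card_coe_set_eq]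
  omega

theorem parentGraph_injOn {V : Type*} (G : SimpleGraph V) (r : V) :
    Set.InjOn (parentGraph r) (parentFunctions G r) := by
  intro f hf g hg hfg
  have key : ∀ k v, f^[k] v = r → f v = g v := by
    intro k
    induction k with
    | zero =>
      intro v hv
      rw [Function.iterate_zero_apply] at hv
      rw [hv, hf.1, hg.1]
    | succ k ih =>
      intro v hv
      by_cases h : v = r
      · rw [h, hf.1, hg.1]
      have h1 := parentGraph_adj_parent hf h
      rw [hfg, parentGraph, SimpleGraph.fromEdgeSet_adj] at h1
      obtain ⟨⟨w, hw, hw'⟩, -⟩ := h1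
      rcases Sym2.eq_iff.1 hw' with ⟨rfl, h2⟩ | ⟨rfl, h2⟩
      · exact h2.symm
      -- Here `g (f v) = v`, so by induction `f (f v) = v`: a 2-cycle avoiding `r`.
      · exfalso
        have h3 := ih _ hv
        rw [h2] at h3
        have h4 : ∀ j, f^[j] v = v ∨ f^[j] v = f v := by
          intro j
          induction j with
          | zero => exact Or.inl rfl
          | succ j ihj =>
            rw [Function.iterate_succ_apply']
            rcases ihj with h5 | h5 <;> rw [h5]
            · exact Or.inr rfl
            · exact Or.inl h3
        rcases h4 (k + 1) with h5 | h5 <;> rw [hv] at h5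
        · exact h h5.symm
        · exact hw h5.symm
  ext v
  obtain ⟨k, hk⟩ := hf.2.2 v
  exact key k v hk

/-- The parent of `v` is a neighbour in `T` closer to `r`. The resulting graph is a connected
subgraph of `T`, hence all of `T` since trees are minimal connected. -/
theorem exists_parentGraph_eq {V : Type*} {G T : SimpleGraph V} (r : V) (hT : T ∈ spanningTrees G) :
    ∃ f ∈ parentFunctions G r, parentGraph r f = T := by
  classical
  obtain ⟨hTG, hT⟩ := hT
  have hstep : ∀ v, v ≠ r → ∃ u, T.Adj v u ∧ T.dist u r < T.dist v r := by
    intro v hv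
    obtain ⟨p, hp⟩ := hT.1.exists_walk_length_eq_dist v r
    cases p with
    | nil => exact absurd rfl hv
    | cons h q =>
      refine ⟨_, h, ?_⟩
      rw [SimpleGraph.Walk.length_cons] at hp
      have := SimpleGraph.dist_le q
      omega
  choose! g hg using hstep
  set f : V → V := fun v => if v = r then r else g v with hfdef
  have hne : ∀ v, v ≠ r → f v = g v := fun v hv => if_neg hv
  have hmem : ∀ H : SimpleGraph V, T ≤ H → f ∈ parentFunctions H r := by
    refine fun H hH => ⟨if_pos rfl, fun v hv => hne v hv ▸ hH (hg v hv).1, ?_⟩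
    have : ∀ m v, T.dist v r < m → ∃ k, f^[k] v = r := by
      intro m
      induction m with
      | zero => intro v hv; omega
      | succ m ih =>
        intro v hv
        by_cases h : v = r
        · exact ⟨0, h⟩
        · have h1 := (hg v h).2
          rw [← hne v h] at h1
          obtain ⟨k, hk⟩ := ih (f v) (by omega)
          exact ⟨k + 1, hk⟩
    exact fun v => this _ v (Nat.lt_succ_self _)
  refine ⟨f, hmem G hTG, ?_⟩
  exact le_antisymm (parentGraph_le (hmem T le_rfl))
    ((SimpleGraph.isTree_iff_minimal_connected.1 hT).2 (parentGraph_connected (hmem T le_rfl))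
      (parentGraph_le (hmem T le_rfl)))

/-- **Kirchhoff's matrix-tree theorem.** -/
theorem adjugate_lapMatrix_apply_self_eq_ncard_spanningTrees {V : Type*} [Fintype V]
    [DecidableEq V] (K : Type*) [Field K] (G : SimpleGraph V) [DecidableRel G.Adj] (r : V) :
    (G.lapMatrix K).adjugate r r = ((spanningTrees G).ncard : K) := by
  rw [adjugate_lapMatrix_apply_self]
  congr 1
  have : spanningTrees G = parentGraph r '' parentFunctions G r := by
    ext T
    refine ⟨fun h => exists_parentGraph_eq r h, ?_⟩
    rintro ⟨f, hf, rfl⟩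
    exact ⟨parentGraph_le hf, parentGraph_isTree hf⟩
  rw [this, (parentGraph_injOn G r).ncard_image]

/-! ### Spectra of `D - U` and `D + 2U` -/

theorem Polynomial.eq_prod_X_sub_C_of_isRoot {K : Type*} [Field K] {p : Polynomial K}
    (hp : p.Monic) (S : Finset K) (hS : ∀ s ∈ S, p.IsRoot s) (hcard : S.card = p.natDegree) :
    p = ∏ s ∈ S, (Polynomial.X - Polynomial.C s) := by
  have hle : S.val ≤ p.roots :=
    (Multiset.le_iff_subset S.nodup).2 fun s hs => (Polynomial.mem_roots hp.ne_zero).2 (hS s hs)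
  have h := Multiset.eq_of_le_of_card_le hle (by
    rw [Finset.card_val, hcard]; exact p.card_roots')
  rw [← Polynomial.prod_multiset_X_sub_C_of_monic_of_roots_card_eq hp
    (by rw [← h, Finset.card_val, hcard]), ← h]
  rfl

/-- The matrix `D + c U` where `D = diag (n + 1 - k)` and `U k l = 1` if `k + l ≤ n`, else `0`. -/
def antitriangularMatrix (n : ℕ) (c : ℚ) : Matrix (Fin (n + 1)) (Fin (n + 1)) ℚ :=
  Matrix.diagonal (fun k : Fin (n + 1) => (n : ℚ) + 1 - (k : ℕ)) +
    c • Matrix.of fun k l : Fin (n + 1) => if (k : ℕ) + l ≤ n then (1 : ℚ) else 0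

/-- With `F` the partial sums of `f` and `m = n + 1 - k`, row `k` applied to `f` is `m * f k + c * F
m`, so `h` is the eigenvector equation. -/
theorem isRoot_charpoly_antitriangularMatrix {n : ℕ} {c s : ℚ} (f F : ℕ → ℚ) (hF0 : F 0 = 0)
    (hF : ∀ m, F (m + 1) = F m + f m)
    (h : ∀ k m, k + m = n + 1 → (m : ℚ) * f k + c * F m = s * f k) {k₀ : ℕ} (hk₀ : k₀ ≤ n)
    (hf : f k₀ ≠ 0) : (antitriangularMatrix n c).charpoly.IsRoot s := by
  rw [Polynomial.IsRoot, Matrix.eval_charpoly, ← Matrix.exists_mulVec_eq_zero_iff]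
  refine ⟨fun k => f k, fun h0 => hf (congrFun h0 ⟨k₀, by omega⟩), ?_⟩
  have hsum : ∀ m, ∑ l ∈ Finset.range m, f l = F m := by
    intro m
    induction m with
    | zero => simp [hF0]
    | succ m ih => rw [Finset.sum_range_succ, ih, hF]
  ext k
  have hk : (k : ℕ) + (n + 1 - k) = n + 1 := by omega
  have h1 := h k (n + 1 - k) hk
  have hsumk : ∑ l : Fin (n + 1), (if (k : ℕ) + l ≤ n then f l else 0) = F (n + 1 - k) := by
    rw [Fin.sum_univ_eq_sum_range (fun l => if (k : ℕ) + l ≤ n then f l else 0) (n + 1),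
      ← Finset.sum_filter, ← hsum]
    refine Finset.sum_congr ?_ fun _ _ => rfl
    ext l
    simp only [Finset.mem_filter, Finset.mem_range]
    omega
  have hcast : ((n + 1 - (k : ℕ) : ℕ) : ℚ) = (n : ℚ) + 1 - (k : ℕ) := by
    rw [Nat.cast_sub (by omega)]; push_cast; rfl
  rw [hcast] at h1
  rw [antitriangularMatrix, Matrix.sub_mulVec, Matrix.add_mulVec, Matrix.smul_mulVec,
    Matrix.scalar_apply, Pi.sub_apply, Pi.add_apply, Pi.smul_apply, Matrix.mulVec_diagonal,
    Matrix.mulVec_diagonal, Pi.zero_apply]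
  have : (Matrix.of (fun k l : Fin (n + 1) => if (k : ℕ) + l ≤ n then (1 : ℚ) else 0)).mulVec
      (fun k => f k) k = F (n + 1 - k) := by
    rw [← hsumk]
    simp [Matrix.mulVec, dotProduct]
  rw [this, smul_eq_mul]
  linarith

theorem isRoot_neg_one_zero (n : ℕ) : (antitriangularMatrix n (-1)).charpoly.IsRoot 0 :=
  isRoot_charpoly_antitriangularMatrix (fun _ => 1) (fun m => m) (by simp) (by simp)
    (fun k m _ => by ring) (Nat.zero_le _) one_ne_zero

/-- The eigenvalue is the entry of `D` at `k = a`. The eigenvector lives on the window `[a, a + N]`,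
symmetric under `k ↦ n - k`, and its entries sum to zero. -/
theorem isRoot_neg_one_top {a N : ℕ} (hN : 1 ≤ N) :
    (antitriangularMatrix (2 * a + N) (-1)).charpoly.IsRoot ((a + N + 1 : ℕ) : ℚ) := by
  refine isRoot_charpoly_antitriangularMatrix
    (fun l => if l < a then 0 else if l = a then (N : ℚ) else if l ≤ a + N then -1 else 0)
    (fun m => if m ≤ a then 0 else if m ≤ a + N + 1 then (N : ℚ) - (m - a - 1) else 0)
    (by simp) ?_ ?_ (k₀ := a) (by omega) (by simp; omega)
  · intro m
    rcases lt_trichotomy m a with h | rfl | h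
    · grind
    · grind
    · rcases lt_trichotomy m (a + N + 1) with h' | rfl | h'
      · grind
      · grind
      · grind
  · intro k m hkm
    have hc : (k : ℚ) + m = 2 * a + N + 1 := by exact_mod_cast hkm
    grind

/-- Here the eigenvalue is the entry of `D` at `k = a + N`; the window is `[a + 1, a + N]`, again
with entries summing to zero. For `N = 1` the vector vanishes. -/
theorem isRoot_neg_one_bot {a N : ℕ} (hN : 2 ≤ N) :
    (antitriangularMatrix (2 * a + N) (-1)).charpoly.IsRoot ((a + 1 : ℕ) : ℚ) := by
  refine isRoot_charpoly_antitriangularMatrix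
    (fun l => if l ≤ a then 0 else if l < a + N then -1 else if l = a + N then (N : ℚ) - 1 else 0)
    (fun m => if m ≤ a then 0 else if m ≤ a + N then -((m : ℚ) - a - 1) else 0)
    (by simp) ?_ ?_ (k₀ := a + 1) (by omega) (by grind)
  · intro m
    rcases lt_trichotomy m a with h | rfl | h
    · grind
    · grind
    · rcases lt_trichotomy m (a + N) with h' | rfl | h'
      · grind
      · grind
      · grind
  · intro k m hkm
    rcases eq_or_ne k (a + N) with rfl | hk
    · obtain rfl : m = a + 1 := by omega
      grind
    have hc : (k : ℚ) + m = 2 * a + N + 1 := by exact_mod_cast hkm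
    grind

theorem isRoot_two_zero {n : ℕ} (hn : 1 ≤ n) :
    (antitriangularMatrix n 2).charpoly.IsRoot 0 := by
  refine isRoot_charpoly_antitriangularMatrix (fun l => (n : ℚ) - 3 * l)
    (fun m => (n : ℚ) * m - 3 * m * (m - 1) / 2) (by simp) (fun m => by push_cast; ring)
    (fun k m hkm => ?_) (Nat.zero_le _) (by simp; omega)
  have hc : (k : ℚ) = n + 1 - m := by rw [eq_sub_iff_add_eq]; exact_mod_cast hkm
  rw [hc]; ring

theorem isRoot_two_perron (n : ℕ) :
    (antitriangularMatrix n 2).charpoly.IsRoot ((2 * n + 3 : ℕ) : ℚ) := by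
  refine isRoot_charpoly_antitriangularMatrix (fun l => (n : ℚ) + 1 - l)
    (fun m => ((n : ℚ) + 1) * m - m * (m - 1) / 2) (by simp) (fun m => by push_cast; ring)
    (fun k m hkm => ?_) (Nat.zero_le _) (by simp; positivity)
  have hc : (k : ℚ) = n + 1 - m := by rw [eq_sub_iff_add_eq]; exact_mod_cast hkm
  rw [hc]; push_cast; ring

/-- Same window as for `c = -1`, but the entries past `a` are now linear in `l`; the one at `a`
makes the total zero. The vector vanishes for `N ≤ 1`. -/
theorem isRoot_two_top {a N : ℕ} (hN : 2 ≤ N) :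
    (antitriangularMatrix (2 * a + N) 2).charpoly.IsRoot ((a + N + 1 : ℕ) : ℚ) := by
  refine isRoot_charpoly_antitriangularMatrix
    (fun l => if l < a then 0 else if l = a then (N : ℚ) * (N - 1) else
      if l ≤ a + N then 6 * ((l : ℚ) - a) - 2 * (2 * N + 1) else 0)
    (fun m => if m ≤ a then 0 else if m ≤ a + N + 1 then (N : ℚ) * (N - 1) +
      3 * (m - a - 1) * (m - a) - 2 * (2 * N + 1) * (m - a - 1) else 0)
    (by simp) ?_ ?_ (k₀ := a) (by omega) ?_
  · intro m
    rcases lt_trichotomy m a with h | rfl | h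
    · grind
    · grind
    · rcases lt_trichotomy m (a + N + 1) with h' | rfl | h'
      · grind
      · grind
      · grind
  · intro k m hkm
    have hc : (k : ℚ) = 2 * a + N + 1 - m := by rw [eq_sub_iff_add_eq]; exact_mod_cast hkm
    grind
  · have : (2 : ℚ) ≤ N := by exact_mod_cast hN
    simp only [lt_irrefl, if_false, if_true]
    nlinarith

theorem isRoot_two_bot {a N : ℕ} (hN : 3 ≤ N) :
    (antitriangularMatrix (2 * a + N) 2).charpoly.IsRoot ((a + 1 : ℕ) : ℚ) := by
  refine isRoot_charpoly_antitriangularMatrix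
    (fun l => if l ≤ a then 0 else if l < a + N then (N : ℚ) + 1 - 3 * (l - a) else
      if l = a + N then ((N : ℚ) - 1) * (N - 2) / 2 else 0)
    (fun m => if m ≤ a then 0 else if m ≤ a + N then
      ((N : ℚ) + 1) * (m - a - 1) - 3 * (m - a - 1) * (m - a) / 2 else 0)
    (by simp) ?_ ?_ (k₀ := a + N) (by omega) ?_
  · intro m
    rcases lt_trichotomy m a with h | rfl | h
    · grind
    · grind
    · rcases lt_trichotomy m (a + N) with h' | rfl | h'
      · grind
      · grind
      · grind
  · intro k m hkm
    rcases eq_or_ne k (a + N) with rfl | hk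
    · obtain rfl : m = a + 1 := by omega
      grind
    have hc : (k : ℚ) = 2 * a + N + 1 - m := by rw [eq_sub_iff_add_eq]; exact_mod_cast hkm
    grind
  · have : (3 : ℚ) ≤ N := by exact_mod_cast hN
    have h1 : ¬ a + N ≤ a := by omega
    simp only [h1, lt_irrefl, if_false, if_true]
    have : 0 < ((N : ℚ) - 1) * (N - 2) := by apply mul_pos <;> linarith
    positivity

open Polynomial in
theorem charpoly_antitriangularMatrix_neg_one (n : ℕ) :
    (antitriangularMatrix n (-1)).charpoly =
      ∏ j ∈ (Finset.range (n + 2)).erase (n / 2 + 1), (X - C (j : ℚ)) := by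
  rw [eq_prod_X_sub_C_of_isRoot (Matrix.charpoly_monic _)
    (((Finset.range (n + 2)).erase (n / 2 + 1)).map Nat.castEmbedding), Finset.prod_map]
  · rfl
  · simp only [Finset.mem_map, Finset.mem_erase, Finset.mem_range, Nat.castEmbedding_apply]
    rintro _ ⟨j, ⟨hj, hj'⟩, rfl⟩
    rcases Nat.eq_zero_or_pos j with rfl | h0
    · simpa using isRoot_neg_one_zero n
    -- Values below the omitted middle are the lower family, values above it the upper one.
    rcases lt_or_gt_of_ne hj with h | h
    · obtain ⟨a, rfl⟩ : ∃ a, j = a + 1 := ⟨j - 1, by omega⟩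
      obtain ⟨N, rfl⟩ : ∃ N, n = 2 * a + N := ⟨n - 2 * a, by omega⟩
      exact isRoot_neg_one_bot (by omega)
    · obtain ⟨a, ha⟩ : ∃ a, n + 1 = j + a := ⟨n + 1 - j, by omega⟩
      obtain ⟨N, rfl⟩ : ∃ N, n = 2 * a + N := ⟨n - 2 * a, by omega⟩
      obtain rfl : j = a + N + 1 := by omega
      exact isRoot_neg_one_top (by omega)
  · rw [Matrix.charpoly_natDegree_eq_dim, Finset.card_map,
      Finset.card_erase_of_mem (Finset.mem_range.2 (by omega))]
    simp

open Polynomial in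
theorem charpoly_antitriangularMatrix_two {n : ℕ} (hn : 1 ≤ n) :
    (antitriangularMatrix n 2).charpoly = (X - C (2 * (n : ℚ) + 3)) *
      ∏ j ∈ ((Finset.range (n + 2)).erase ((n + 1) / 2)).erase ((n + 1) / 2 + 1),
        (X - C (j : ℚ)) := by
  rw [eq_prod_X_sub_C_of_isRoot (Matrix.charpoly_monic _)
    ((insert (2 * n + 3) (((Finset.range (n + 2)).erase ((n + 1) / 2)).erase
      ((n + 1) / 2 + 1))).map Nat.castEmbedding), Finset.prod_map, Finset.prod_insert]
  · simp
  · simp; omega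
  · simp only [Finset.mem_map, Finset.mem_insert, Finset.mem_erase, Finset.mem_range,
      Nat.castEmbedding_apply]
    rintro _ ⟨j, rfl | ⟨hj, hj', hj''⟩, rfl⟩
    · exact isRoot_two_perron n
    rcases Nat.eq_zero_or_pos j with rfl | h0
    · simpa using isRoot_two_zero hn
    rcases lt_or_gt_of_ne hj' with h | h
    · obtain ⟨a, rfl⟩ : ∃ a, j = a + 1 := ⟨j - 1, by omega⟩
      obtain ⟨N, rfl⟩ : ∃ N, n = 2 * a + N := ⟨n - 2 * a, by omega⟩
      exact isRoot_two_bot (by omega)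
    · obtain ⟨a, ha⟩ : ∃ a, n + 1 = j + a := ⟨n + 1 - j, by omega⟩
      obtain ⟨N, rfl⟩ : ∃ N, n = 2 * a + N := ⟨n - 2 * a, by omega⟩
      obtain rfl : j = a + N + 1 := by omega
      exact isRoot_two_top (by omega)
  · rw [Matrix.charpoly_natDegree_eq_dim, Finset.card_map, Finset.card_insert_of_notMem,
      Finset.card_erase_of_mem, Finset.card_erase_of_mem]
    · simp
    · simp; omega
    · simp; omega
    · simp; omega

/-! ### Counting vertices on lines -/

theorem finite_simplicialRookVertex (d n : ℕ) : Finite (SimplicialRookVertex d n) :=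
  Finite.of_injective
    (fun x i => (⟨x.1 i, Nat.lt_succ_of_le (x.2.1 i)⟩ : Fin (n + 1)))
    fun _ _ h => Subtype.ext (funext fun i => congrArg Fin.val (congrFun h i))

noncomputable instance instFintypeSimplicialRookVertex (d n : ℕ) :
    Fintype (SimplicialRookVertex d n) :=
  have := finite_simplicialRookVertex d n
  Fintype.ofFinite _

theorem Fin.exists_third {i j : Fin 3} (hij : i ≠ j) :
    ∃ t, t ≠ i ∧ t ≠ j ∧ (∀ u, u = i ∨ u = j ∨ u = t) ∧
      ∀ g : Fin 3 → ℕ, ∑ u, g u = g i + g j + g t := by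
  obtain ⟨t, h1, h2, h3⟩ : ∃ t, t ≠ i ∧ t ≠ j ∧ ∀ u, u = i ∨ u = j ∨ u = t := by
    revert i j; decide
  refine ⟨t, h1, h2, h3, fun g => ?_⟩
  have : (Finset.univ : Finset (Fin 3)) = {i, j, t} := by
    ext u; simpa using h3 u
  rw [this, Finset.sum_insert (by simp [hij, h1.symm]), Finset.sum_pair h2.symm, add_assoc]

theorem sum_simplicialRookVertex_ite_and (n : ℕ) {i j : Fin 3} (hij : i ≠ j) (k l : ℕ) :
    ∑ x : SimplicialRookVertex 3 n, (if x.1 i = k ∧ x.1 j = l then (1 : ℚ) else 0) =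
      if k + l ≤ n then 1 else 0 := by
  obtain ⟨t, hti, htj, hcov, hsum⟩ := Fin.exists_third hij
  split_ifs with h
  · let x₀ : SimplicialRookVertex 3 n :=
      ⟨fun u => if u = i then k else if u = j then l else n - k - l, by
        intro u; dsimp only; split_ifs <;> omega, by
        rw [hsum]; simp only [hij.symm, hti, htj, if_true, if_false]; omega⟩
    have hx₀ : ∀ x : SimplicialRookVertex 3 n, (x.1 i = k ∧ x.1 j = l) ↔ x = x₀ := by
      intro x
      constructor
      · rintro ⟨h1, h2⟩
        have h3 := x.2.2
        rw [hsum] at h3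
        ext u
        rcases hcov u with rfl | rfl | rfl
        · simp [x₀, h1]
        · simp [x₀, h2, hij.symm]
        · simp only [x₀, hti, htj, if_false]; omega
      · rintro rfl
        simp [x₀, hij.symm]
    simp [hx₀]
  · refine Finset.sum_eq_zero fun x _ => if_neg ?_
    rintro ⟨h1, h2⟩
    have h3 := x.2.2
    rw [hsum] at h3
    omega

theorem sum_ite_add_le {n k : ℕ} (hk : k ≤ n) :
    ∑ l : Fin (n + 1), (if k + l ≤ n then (1 : ℚ) else 0) = n + 1 - k := by
  rw [Fin.sum_univ_eq_sum_range (fun l => if k + l ≤ n then (1 : ℚ) else 0) (n + 1),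
    ← Finset.sum_filter]
  have : (Finset.range (n + 1)).filter (fun l => k + l ≤ n) = Finset.range (n + 1 - k) := by
    ext l; simp only [Finset.mem_filter, Finset.mem_range]; omega
  rw [this, Finset.sum_const, Finset.card_range, nsmul_one, Nat.cast_sub (by omega)]
  push_cast; rfl

theorem sum_fin_ite_eq {n a : ℕ} (ha : a ≤ n) (b : ℚ) :
    ∑ l : Fin (n + 1), (if a = l then b else 0) = b := by
  rw [Finset.sum_eq_single ⟨a, Nat.lt_succ_of_le ha⟩]
  · simp
  · intro l _ hl
    exact if_neg fun h => hl (Fin.ext h.symm)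
  · simp

theorem sum_simplicialRookVertex_ite (n : ℕ) (i : Fin 3) {k : ℕ} (hk : k ≤ n) :
    ∑ x : SimplicialRookVertex 3 n, (if x.1 i = k then (1 : ℚ) else 0) = n + 1 - k := by
  obtain ⟨j, hij⟩ : ∃ j, i ≠ j := by revert i; decide
  rw [← sum_ite_add_le hk]
  simp_rw [← sum_simplicialRookVertex_ite_and n hij]
  rw [Finset.sum_comm]
  refine Finset.sum_congr rfl fun x _ => ?_
  by_cases h : x.1 i = k
  · simp only [h, true_and, if_true]
    exact (sum_fin_ite_eq (x.2.1 j) 1).symm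
  · simp [h]

theorem card_simplicialRookVertex_three (n : ℕ) :
    (Fintype.card (SimplicialRookVertex 3 n) : ℚ) = (n + 1) * (n + 2) / 2 := by
  have h1 : (Fintype.card (SimplicialRookVertex 3 n) : ℚ) =
      ∑ k : Fin (n + 1), ((n : ℚ) + 1 - (k : ℕ)) := by
    rw [Finset.sum_congr rfl fun (k : Fin (n + 1)) _ =>
      (sum_simplicialRookVertex_ite n 0 k.is_le).symm, Finset.sum_comm,
      Finset.sum_congr rfl fun (x : SimplicialRookVertex 3 n) _ => sum_fin_ite_eq (x.2.1 0) 1]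
    simp
  have h2 : ∀ m, ∑ k ∈ Finset.range m, ((n : ℚ) + 1 - k) = m * (n + 1) - m * (m - 1) / 2 := by
    intro m
    induction m with
    | zero => simp
    | succ m ih => rw [Finset.sum_range_succ, ih]; push_cast; ring
  rw [h1, Fin.sum_univ_eq_sum_range (fun k => (n : ℚ) + 1 - k) (n + 1), h2]
  push_cast
  ring

/-! ### The Laplacian through line incidences -/

/-- Incidence matrix between the vertices of `SR(3, n)` and the lines `x i = k`. -/
def lineIncidence (n : ℕ) : Matrix (SimplicialRookVertex 3 n) (Fin (n + 1) × Fin 3) ℚ :=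
  Matrix.of fun x p => if x.1 p.2 = p.1 then 1 else 0

open Matrix in
theorem lineIncidence_mul_transpose_apply (n : ℕ) (x y : SimplicialRookVertex 3 n) :
    (lineIncidence n * (lineIncidence n)ᵀ) x y = ∑ i : Fin 3, if x.1 i = y.1 i then (1 : ℚ) else 0 := by
  rw [Matrix.mul_apply, Fintype.sum_prod_type_right]
  refine Finset.sum_congr rfl fun i _ => ?_
  rw [← sum_fin_ite_eq (x.2.1 i) (if x.1 i = y.1 i then (1 : ℚ) else 0)]
  refine Finset.sum_congr rfl fun k _ => ?_
  simp only [lineIncidence, of_apply, transpose_apply]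
  by_cases h : x.1 i = k
  · simp [h, eq_comm]
  · simp [h]

-- As the coordinate sum is fixed, distinct vertices agree in at most one coordinate; agreeing in
-- one means differing in exactly two.
open Matrix in
theorem lineIncidence_mul_transpose_apply_of_ne (n : ℕ) {x y : SimplicialRookVertex 3 n}
    [DecidableRel (simplicialRookGraph 3 n).Adj] (hxy : x ≠ y) :
    (lineIncidence n * (lineIncidence n)ᵀ) x y =
      if (simplicialRookGraph 3 n).Adj x y then 1 else 0 := by
  have hadj : (simplicialRookGraph 3 n).Adj x y ↔
    (Finset.univ.filter fun i => x.1 i ≠ y.1 i).card = 2 := Iff.rfl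
  have hne : ∃ i, x.1 i ≠ y.1 i := by
    by_contra! h
    exact hxy (Subtype.ext (funext h))
  have hx := x.2.2
  have hy := y.2.2
  rw [lineIncidence_mul_transpose_apply, if_congr hadj rfl rfl]
  rw [Fin.sum_univ_three] at hx hy ⊢
  rw [Finset.card_filter, Fin.sum_univ_three]
  rw [Fin.exists_fin_succ, Fin.exists_fin_two] at hne
  by_cases h0 : x.1 0 = y.1 0 <;> by_cases h1 : x.1 1 = y.1 1 <;> by_cases h2 : x.1 2 = y.1 2 <;>
    simp [h0, h1, h2] at hne ⊢ <;> omega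

open Matrix in
theorem lapMatrix_simplicialRookGraph (n : ℕ) [DecidableRel (simplicialRookGraph 3 n).Adj] :
    (simplicialRookGraph 3 n).lapMatrix ℚ =
      Matrix.scalar _ (2 * (n : ℚ) + 3) - lineIncidence n * (lineIncidence n)ᵀ := by
  have hself : ∀ x : SimplicialRookVertex 3 n, (lineIncidence n * (lineIncidence n)ᵀ) x x = 3 := by
    intro x
    rw [lineIncidence_mul_transpose_apply]
    simp
  ext x y
  by_cases hxy : x = y
  · subst hxy
    have hdeg : ((simplicialRookGraph 3 n).degree x : ℚ) = 2 * n := by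
      -- The three lines through `x` have `n + 1 - x i` points each, in total `3(n + 1) - n`.
      have h1 : ∑ y, (lineIncidence n * (lineIncidence n)ᵀ) x y = 2 * n + 3 := by
        simp_rw [lineIncidence_mul_transpose_apply]
        rw [Finset.sum_comm]
        simp_rw [eq_comm (a := x.1 _), sum_simplicialRookVertex_ite n _ (x.2.1 _)]
        rw [Finset.sum_sub_distrib, ← Nat.cast_sum, x.2.2]
        simp; ring
      rw [← Finset.add_sum_erase _ _ (Finset.mem_univ x), hself, Finset.sum_congr rfl fun y hy =>
        lineIncidence_mul_transpose_apply_of_ne n (Finset.ne_of_mem_erase hy).symm,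
        Finset.sum_erase _ (by simp), Finset.sum_boole] at h1
      rw [← SimpleGraph.card_neighborFinset_eq_degree, SimpleGraph.neighborFinset_eq_filter]
      linarith
    rw [Matrix.sub_apply, hself, SimpleGraph.lapMatrix, Matrix.sub_apply, SimpleGraph.degMatrix, diagonal_apply_eq,
      hdeg, SimpleGraph.adjMatrix_apply, if_neg (SimpleGraph.irrefl _), scalar_apply,
      diagonal_apply_eq]
    ring
  · rw [Matrix.sub_apply, lineIncidence_mul_transpose_apply_of_ne n hxy, SimpleGraph.lapMatrix, Matrix.sub_apply,
      SimpleGraph.degMatrix, diagonal_apply_ne _ hxy, SimpleGraph.adjMatrix_apply, scalar_apply,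
      diagonal_apply_ne _ hxy]

-- Distinct lines of one direction are disjoint; lines of different directions meet in one vertex
-- iff `k + l ≤ n`.
open Matrix Kronecker in
theorem transpose_mul_lineIncidence (n : ℕ) :
    (lineIncidence n)ᵀ * lineIncidence n =
      diagonal (fun k : Fin (n + 1) => (n : ℚ) + 1 - (k : ℕ)) ⊗ₖ (1 : Matrix (Fin 3) (Fin 3) ℚ) +
      (of fun k l : Fin (n + 1) => if (k : ℕ) + l ≤ n then (1 : ℚ) else 0) ⊗ₖ
        (of fun i j : Fin 3 => if i = j then (0 : ℚ) else 1) := by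
  ext ⟨k, i⟩ ⟨l, j⟩
  rw [mul_apply, Matrix.add_apply, kronecker_apply, kronecker_apply, of_apply, of_apply]
  have h1 : ∀ x : SimplicialRookVertex 3 n, (lineIncidence n)ᵀ (k, i) x * lineIncidence n x (l, j)
      = if x.1 i = k ∧ x.1 j = l then 1 else 0 := by
    intro x
    simp [lineIncidence, transpose_apply, ← ite_and, and_comm]
  simp_rw [h1]
  by_cases hij : i = j
  · subst hij
    by_cases hkl : k = l
    · subst hkl
      simp only [and_self]
      rw [sum_simplicialRookVertex_ite n i k.is_le]
      simp
    · have : ∀ a : ℕ, ¬ (a = k ∧ a = l) := fun a ⟨h, h'⟩ => hkl (Fin.ext (h.symm.trans h'))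
      simp [this, hkl]
  · rw [sum_simplicialRookVertex_ite_and n hij]
    simp [hij]

/-! ### Block diagonalisation of the line Gram matrix -/

open Matrix in
theorem charpoly_blockDiagonal {R m o : Type*} [CommRing R] [Fintype m] [DecidableEq m]
    [Fintype o] [DecidableEq o] (M : o → Matrix m m R) :
    (blockDiagonal M).charpoly = ∏ k, (M k).charpoly := by
  simp_rw [charpoly]
  rw [← det_blockDiagonal]
  congr 1
  ext ⟨i, k⟩ ⟨j, l⟩
  by_cases hkl : k = l
  · subst hkl
    simp [charmatrix_apply, blockDiagonal_apply, diagonal_apply]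
  · simp [blockDiagonal_apply, hkl]

open Matrix Kronecker in
theorem charpoly_transpose_mul_lineIncidence (n : ℕ) :
    ((lineIncidence n)ᵀ * lineIncidence n).charpoly =
      (antitriangularMatrix n (-1)).charpoly ^ 2 * (antitriangularMatrix n 2).charpoly := by
  -- The columns of `P` are eigenvectors of `J - I` for `2, -1, -1`, and `Q` is its inverse.
  set P : Matrix (Fin 3) (Fin 3) ℚ := !![1, 1, 1; 1, -1, 0; 1, 0, -1] with hP
  set Q : Matrix (Fin 3) (Fin 3) ℚ := !![1/3, 1/3, 1/3; 1/3, -2/3, 1/3; 1/3, 1/3, -2/3] with hQ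
  have hQP : Q * P = 1 := by
    rw [hP, hQ, one_fin_three]; simp; norm_num
  have hPQ : P * Q = 1 := mul_eq_one_comm.1 hQP
  have hJ : Q * (of fun i j : Fin 3 => if i = j then (0 : ℚ) else 1) * P =
      diagonal ![2, -1, -1] := by
    have : (of fun i j : Fin 3 => if i = j then (0 : ℚ) else 1) =
        !![0, 1, 1; 1, 0, 1; 1, 1, 0] := by
      ext i j
      fin_cases i <;> fin_cases j <;> rfl
    rw [this]
    ext i j
    fin_cases i <;> fin_cases j <;> simp [mul_apply, Fin.sum_univ_three, hP, hQ] <;> norm_num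
  have h1 : ((lineIncidence n)ᵀ * lineIncidence n).charpoly =
      (((1 : Matrix (Fin (n + 1)) (Fin (n + 1)) ℚ) ⊗ₖ Q) *
        ((lineIncidence n)ᵀ * lineIncidence n) *
        ((1 : Matrix (Fin (n + 1)) (Fin (n + 1)) ℚ) ⊗ₖ P)).charpoly := by
    rw [mul_assoc, charpoly_mul_comm, mul_assoc, ← mul_kronecker_mul, hPQ, one_mul,
      one_kronecker_one, mul_one]
  rw [h1, transpose_mul_lineIncidence, mul_add, add_mul, ← mul_kronecker_mul, ← mul_kronecker_mul,
    ← mul_kronecker_mul, ← mul_kronecker_mul, hJ]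
  simp only [one_mul, mul_one, hQP]
  have h2 : diagonal (fun k : Fin (n + 1) => (n : ℚ) + 1 - (k : ℕ)) ⊗ₖ (1 : Matrix (Fin 3) (Fin 3) ℚ) +
      (of fun k l : Fin (n + 1) => if (k : ℕ) + l ≤ n then (1 : ℚ) else 0) ⊗ₖ
        diagonal ![2, -1, -1] =
      blockDiagonal fun i : Fin 3 => antitriangularMatrix n (![2, -1, -1] i) := by
    rw [← diagonal_one, kronecker_diagonal, kronecker_diagonal, ← blockDiagonal_add]
    congr 1
    ext i k l
    simp [antitriangularMatrix, mul_comm]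
  rw [h2, charpoly_blockDiagonal, Fin.prod_univ_three]
  simp
  ring

/-! ### Evaluating the spanning tree count -/

open Matrix Polynomial in
theorem eval_derivative_charpoly_lineIncidence (n : ℕ) :
    (derivative (lineIncidence n * (lineIncidence n)ᵀ).charpoly).eval (2 * (n : ℚ) + 3) =
      (n + 1) * (n + 2) / 2 * (spanningTrees (simplicialRookGraph 3 n)).ncard := by
  classical
  have hmap : (evalRingHom (2 * (n : ℚ) + 3)).mapMatrix
      (lineIncidence n * (lineIncidence n)ᵀ).charmatrix =
      (simplicialRookGraph 3 n).lapMatrix ℚ := by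
    rw [lapMatrix_simplicialRookGraph]
    ext x y
    by_cases hxy : x = y
    · subst hxy; simp
    · simp [hxy]
  rw [derivative_charpoly, eval_finsetSum, ← card_simplicialRookVertex_three, ← nsmul_eq_mul,
    ← Finset.card_univ]
  refine Finset.sum_eq_card_nsmul fun x _ => ?_
  rw [← adjugate_lapMatrix_apply_self_eq_ncard_spanningTrees ℚ _ x, ← hmap, ← RingHom.map_adjugate]
  rfl

-- The powers of `2n + 3` stay on both sides because either of `N Nᵀ` and `Nᵀ N` may be the larger
-- matrix.
open Polynomial in
theorem pow_mul_ncard_spanningTrees {n : ℕ} (hn : 1 ≤ n) :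
    (2 * (n : ℚ) + 3) ^ (3 * (n + 1)) * ((n + 1) * (n + 2) / 2 *
        (spanningTrees (simplicialRookGraph 3 n)).ncard) =
      (2 * (n : ℚ) + 3) ^ Fintype.card (SimplicialRookVertex 3 n) *
        ((∏ j ∈ (Finset.range (n + 2)).erase (n / 2 + 1), (2 * (n : ℚ) + 3 - j)) ^ 2 *
          ∏ j ∈ ((Finset.range (n + 2)).erase ((n + 1) / 2)).erase ((n + 1) / 2 + 1),
            (2 * (n : ℚ) + 3 - j)) := by
  have h := Matrix.charpoly_mul_comm' (lineIncidence n) (lineIncidence n).transpose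
  rw [charpoly_transpose_mul_lineIncidence, charpoly_antitriangularMatrix_neg_one,
    charpoly_antitriangularMatrix_two hn, Fintype.card_prod, Fintype.card_fin, Fintype.card_fin,
    mul_comm (n + 1) 3] at h
  rw [← eval_derivative_charpoly_lineIncidence]
  set χ := (lineIncidence n * (lineIncidence n).transpose).charpoly
  set s := 2 * (n : ℚ) + 3 with hs
  have hs0 : s ≠ 0 := by positivity
  have h0 : χ.eval s = 0 := by
    have := congrArg (eval s) h
    simpa [hs0] using this
  have h1 := congrArg (fun p => eval s (derivative p)) h
  -- With the factor `X - s` brought forward, only the term differentiating it survives at `s`.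
  rw [mul_left_comm, mul_left_comm (X ^ _)] at h1
  simp only [derivative_mul, eval_add, eval_mul, h0, derivative_sub, derivative_X, derivative_C,
    eval_sub, eval_X, eval_C, sub_self, mul_zero, zero_mul, zero_add, add_zero, sub_zero,
    one_mul, eval_pow, eval_prod] at h1
  exact h1.trans (mul_left_comm _ _ _)

theorem prod_range_sub_eq (n : ℕ) :
    ∏ j ∈ Finset.range (n + 2), (2 * (n : ℚ) + 3 - j) =
      (2 * n + 3) * ∏ a ∈ Finset.Icc (n + 2) (2 * n + 2), (a : ℚ) := by
  rw [Finset.prod_range_succ', mul_comm]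
  congr 1
  · simp
  · refine Finset.prod_bij' (fun j _ => 2 * n + 2 - j) (fun a _ => 2 * n + 2 - a) ?_ ?_ ?_ ?_ ?_
    · intro j hj; rw [Finset.mem_range] at hj; rw [Finset.mem_Icc]; omega
    · intro a ha; rw [Finset.mem_Icc] at ha; rw [Finset.mem_range]; omega
    · intro j hj; rw [Finset.mem_range] at hj; omega
    · intro a ha; rw [Finset.mem_Icc] at ha; omega
    · intro j hj
      rw [Finset.mem_range] at hj
      rw [Nat.cast_sub (by omega)]
      push_cast
      ring

theorem card_simplicialRookVertex_three_eq_add_choose {n : ℕ} (hn : 1 ≤ n) :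
    Fintype.card (SimplicialRookVertex 3 n) = 3 * n + (n - 1).choose 2 := by
  have : (Fintype.card (SimplicialRookVertex 3 n) : ℚ) = (3 * n + (n - 1).choose 2 : ℕ) := by
    rw [card_simplicialRookVertex_three]
    push_cast
    rw [Nat.cast_choose_two, Nat.cast_sub hn]
    push_cast
    ring
  exact_mod_cast this

/-- Multiplying by the four omitted factors completes three full products over `j`. Each contributes
a factor `2n + 3` from `j = 0`, which leaves the exponent `|V| + 3 - 3(n + 1) = (n - 1).choose 2`.
-/
theorem ncard_spanningTrees_mul {n : ℕ} (hn : 1 ≤ n) :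
    (n + 1) * (n + 2) / 2 * ((spanningTrees (simplicialRookGraph 3 n)).ncard : ℚ) *
        ((2 * (n : ℚ) + 3 - (n / 2 + 1 : ℕ)) ^ 2 * ((2 * (n : ℚ) + 3 - ((n + 1) / 2 : ℕ)) *
          (2 * (n : ℚ) + 3 - ((n + 1) / 2 + 1 : ℕ)))) =
      (2 * (n : ℚ) + 3) ^ (n - 1).choose 2 * ∏ a ∈ Finset.Icc (n + 2) (2 * n + 2), (a : ℚ) ^ 3 := by
  have h := pow_mul_ncard_spanningTrees hn
  have h1 := Finset.mul_prod_erase (Finset.range (n + 2)) (fun j => 2 * (n : ℚ) + 3 - j)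
    (a := n / 2 + 1) (Finset.mem_range.2 (by omega))
  have h2 := Finset.mul_prod_erase (Finset.range (n + 2)) (fun j => 2 * (n : ℚ) + 3 - j)
    (a := (n + 1) / 2) (Finset.mem_range.2 (by omega))
  rw [← Finset.mul_prod_erase _ _ (Finset.mem_erase.2 ⟨Nat.succ_ne_self _,
    Finset.mem_range.2 (show (n + 1) / 2 + 1 < n + 2 by omega)⟩)] at h2
  rw [prod_range_sub_eq] at h1 h2
  rw [card_simplicialRookVertex_three_eq_add_choose hn] at h
  rw [Finset.prod_pow]
  have hs : (2 * (n : ℚ) + 3) ≠ 0 := by positivity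
  refine mul_left_cancel₀ (pow_ne_zero (3 * (n + 1)) hs) ?_
  generalize (∏ j ∈ (Finset.range (n + 2)).erase (n / 2 + 1), (2 * (n : ℚ) + 3 - j)) = A at *
  generalize (∏ j ∈ ((Finset.range (n + 2)).erase ((n + 1) / 2)).erase ((n + 1) / 2 + 1),
            (2 * (n : ℚ) + 3 - j)) = B at *
  generalize (∏ a ∈ Finset.Icc (n + 2) (2 * n + 2), (a : ℚ)) = R at *
  generalize ((spanningTrees (simplicialRookGraph 3 n)).ncard : ℚ) = τ at *
  generalize (2 * (n : ℚ) + 3 - (n / 2 + 1 : ℕ)) = u at *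
  generalize (2 * (n : ℚ) + 3 - ((n + 1) / 2 : ℕ)) = v at *
  generalize (2 * (n : ℚ) + 3 - ((n + 1) / 2 + 1 : ℕ)) = w at *
  generalize 2 * (n : ℚ) + 3 = s at *
  calc _ = (s ^ (3 * (n + 1)) * ((n + 1) * (n + 2) / 2 * τ)) * (u ^ 2 * (v * w)) := by ring
    _ = s ^ (3 * n + (n - 1).choose 2) * ((u * A) ^ 2 * (v * (w * B))) := by rw [h]; ring
    _ = _ := by rw [h1, h2]; ring

theorem corollary2 (n : ℕ) (hn : 1 ≤ n) :
    (Odd n →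
      ((spanningTrees (simplicialRookGraph 3 n)).ncard : ℚ) =
        (32 * (2 * (n : ℚ) + 3) ^ ((n - 1).choose 2) *
            ∏ a ∈ Finset.Icc (n + 2) (2 * n + 2), (a : ℚ) ^ 3) /
          (3 * ((n : ℚ) + 1) ^ 2 * ((n : ℚ) + 2) * (3 * (n : ℚ) + 5) ^ 3)) ∧
    (Even n →
      ((spanningTrees (simplicialRookGraph 3 n)).ncard : ℚ) =
        (32 * (2 * (n : ℚ) + 3) ^ ((n - 1).choose 2) *
            ∏ a ∈ Finset.Icc (n + 2) (2 * n + 2), (a : ℚ) ^ 3) /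
          (3 * ((n : ℚ) + 1) * ((n : ℚ) + 2) ^ 2 * (3 * (n : ℚ) + 4) ^ 3)) := by
  have h := ncard_spanningTrees_mul hn
  constructor
  -- The omitted factors are `(3n + 5) / 2` three times and `3(n + 1) / 2`.
  · rintro ⟨m, rfl⟩
    have h1 : (2 * m + 1) / 2 = m := by omega
    have h2 : (2 * m + 1 + 1) / 2 = m + 1 := by omega
    rw [h1, h2] at h
    rw [eq_div_iff (by positivity), mul_assoc 32, ← h]
    push_cast
    ring
  -- The omitted factors are `(3n + 4) / 2` three times and `3(n + 2) / 2`.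
  · rintro ⟨m, rfl⟩
    have h1 : (m + m) / 2 = m := by omega
    have h2 : (m + m + 1) / 2 = m := by omega
    rw [h1, h2] at h
    rw [eq_div_iff (by positivity), mul_assoc 32, ← h]
    push_cast
    ring
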